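/- Consider the system $x(t+1)=Ax(t)+Bu(t)$, where $A\in\mathbb R^{n\times n}$ is in Jordan form with (real) distinct eigenvalues $\lambda_1,\dots,\lambda_r$: $A=\mathrm{diag}\{A^{\ell,h}\}$, where $A^{\ell,h}$, $1\le h\le g_\ell$, is the $h$-th upper triangular Jordan miniblock of $\lambda_\ell$, of size $d^{\ell,h}\ge 1$. Call $\ell$ (and its miniblocks) unstable if $|\lambda_\ell|\ge 1$. Agents $i=1,\dots,N$ measure $y_i(t)=C_ix(t)\in\mathbb R^{p_i}$ and communicate over a weighted digraph with nonnegative adjacency matrix $\mathcal A$ with zero diagonal (the neighbours of $i$ being $\mathcal N_i=\{j:[\mathcal A]_{i,j}>0\}$) and Laplacian $\mathcal L=\mathrm{diag}\{\sum_j[\mathcal A]_{i,j}\}_i-\mathcal A$. Let $x^{\ell,h}$ and $C_i^{\ell,h}$ be the blocks of $x$ and $C_i$ corresponding to $A^{\ell,h}$ and, if $C_i^{\ell,h}\neq 0$, let $t_i^{\ell,h}$ be the index of its first nonzero column. For agent $i$ the miniblock $(\ell,h)$ is completely unobservable if $C_i^{\ell,h}=0$, partly observable if $C_i^{\ell,h}\ne0$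 and $t_i^{\ell,h}>1$, and completely observable if $C_i^{\ell,h}\ne 0$ and $t_i^{\ell,h}=1$. Let $\mathcal V_3^{\ell,h}$ be the set of agents for which it is completely observable, and let $\mathcal L^{\ell,h}$ be obtained from $\mathcal L$ by deleting the rows and columns indexed in $\mathcal V_3^{\ell,h}$. Assume that $(A,\mathrm{col}\{C_i\}_i)$ is detectable and that, for every agent $i$ and every unstable $\ell$, the vectors $C_i^{\ell,h}e_{t_i^{\ell,h}}$, over all $h$ with $C_i^{\ell,h}\ne0$, are linearly independent. For agent $i$, let $z_{i,d}$ collect the entries of $x$ in stable blocks and in unstable completely observable miniblocks, together with the entries of index $\geq t_i^{\ell,h}$ of each unstable partly observable miniblock. Let $x_{i,d}$ be the part of $x$ (contained in $z_{i,d}$) made of the stable blocks and the unstable completely observable miniblocks, and let $x_{i,u}$ collect the remaining miniblocks of $x$. Let $F_{i,d},G_{i,d},H_{i,d}$ be the submatrices of $A,B,C_i$ corresponding to $z_{i,d}$, and $A_{i,u},B_{i,u}$ the submatrices of $A,B$ corresponding to $x_{i,u}$. A distributed observer of augmented order is given by real matrices $L_{i,d}$ and real gains $k^{\ell,h}$ (independent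 of $i$), such that the observers $$\hat z_{i,d}(t+1)=F_{i,d}\hat z_{i,d}(t)+G_{i,d}u(t)+L_{i,d}\bigl(y_i(t)-H_{i,d}\hat z_{i,d}(t)\bigr),$$ $$\hat x_{i,u}(t+1)=A_{i,u}\hat x_{i,u}(t)+B_{i,u}u(t)+K_iA_{i,u}\sum_{j\in\mathcal N_i}[\mathcal A]_{i,j}\,\bigl(\hat x_j(t)-\hat x_i(t)\bigr)_{i,u}$$ satisfy $x(t)-\hat x_i(t)\to0$ as $t\to+\infty$ for every $i$, every input and all initial conditions. Here $K_i$ is the block diagonal matrix with blocks $k^{\ell,h}I_{d^{\ell,h}}$ over the miniblocks in $x_{i,u}$, $(\cdot)_{i,u}$ extracts the entries corresponding to $x_{i,u}$, and $\hat x_i$ is the estimate of $x$ whose $x_{i,u}$-part is $\hat x_{i,u}$ and whose $x_{i,d}$-part is the corresponding part of $\hat z_{i,d}$. Then a distributed observer of augmented order exists if and only if for every unstable miniblock $(\ell,h)$ there is $k^{\ell,h}\in\mathbb R$ such that $$|1-k^{\ell,h}\mu|<\frac1{|\lambda_\ell|}\qquad\text{for all (complex) }\mu\in\sigma(\mathcal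 L^{\ell,h}).$$ When one exists, it can be chosen so that moreover all matrices $F_{i,d}-L_{i,d}H_{i,d}$ are Schur (all eigenvalues in the open unit disc). Finally, this condition is implied by the condition for the non-augmented observer, which is the same condition with $\sigma(\mathcal L^{\ell,h})$ replaced by $\sigma\bigl(S^{\ell,h}(\mathcal L^{\ell,h}\otimes I_{d^{\ell,h}})(S^{\ell,h})^\top\bigr)$. Here $S^{\ell,h}$ is the block diagonal matrix whose blocks, for the agents $i\notin\mathcal V_3^{\ell,h}$, are $I_{d^{\ell,h}}$ if $C_i^{\ell,h}=0$ and $[\,I_{t_i^{\ell,h}-1}\ \ 0\,]$ otherwise. -/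

import Mathlib

open scoped Classical Matrix Kronecker
open Filter Topology

noncomputable section

namespace DistObs

/-- A square real matrix is Schur if all its (complex) eigenvalues lie in the open unit disc. -/
def IsSchur {ι : Type} [Fintype ι] (M : Matrix ι ι ℝ) : Prop :=
  ∀ z ∈ spectrum ℂ (M.map (algebraMap ℝ ℂ)), ‖z‖ < 1

/-- The pair `(A, C)` is detectable: some output injection makes `A - L C` Schur. -/
def IsDetectable {ι κ : Type} [Fintype ι] [Fintype κ]
    (A : Matrix ι ι ℝ) (C : Matrix κ ι ℝ) : Prop :=
  ∃ L : Matrix ι κ ℝ, IsSchur (A - L * C)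

/-- The `d × d` Jordan miniblock: `a` on the diagonal, `1` on the first superdiagonal. -/
def miniblock (a : ℝ) (d : ℕ) : Matrix (Fin d) (Fin d) ℝ :=
  Matrix.of fun i j => if i = j then a else if (i : ℕ) + 1 = (j : ℕ) then 1 else 0

/-- The data of a real matrix in Jordan form with real eigenvalues: `r` distinct eigenvalues,
`g ℓ ≥ 1` miniblocks for the `ℓ`-th one, of sizes `d ℓ h ≥ 1`. -/
structure JordanData where
  r : ℕ
  eig : Fin r → ℝ
  eig_injective : Function.Injective eig
  g : Fin r → ℕ
  g_pos : ∀ ℓ, 0 < g ℓ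
  d : ∀ ℓ, Fin (g ℓ) → ℕ
  d_pos : ∀ ℓ h, 0 < d ℓ h

/-- The state coordinates: `⟨ℓ, h, m⟩` is the `m`-th entry of the block `x^{ℓ,h}`. -/
abbrev JordanData.Idx (J : JordanData) : Type :=
  Σ ℓ : Fin J.r, Σ h : Fin (J.g ℓ), Fin (J.d ℓ h)

/-- The matrix in Jordan form, `A = diag_ℓ (diag_h A^{ℓ,h})`. -/
def JordanData.A (J : JordanData) : Matrix J.Idx J.Idx ℝ :=
  Matrix.blockDiagonal' fun ℓ => Matrix.blockDiagonal' fun h => miniblock (J.eig ℓ) (J.d ℓ h)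

/-- A weighted digraph on `N` nodes without self-loops, given by its nonnegative adjacency matrix;
`(j, i)` is an edge iff `adj i j > 0`. -/
structure WDigraph (N : ℕ) where
  adj : Matrix (Fin N) (Fin N) ℝ
  adj_nonneg : ∀ i j, 0 ≤ adj i j
  adj_diag : ∀ i, adj i i = 0

/-- The neighbours of `i`: the nodes `j` with an edge from `j` to `i`. -/
def WDigraph.nbr {N : ℕ} (G : WDigraph N) (i : Fin N) : Finset (Fin N) :=
  Finset.univ.filter fun j => 0 < G.adj i j

/-- The Laplacian: in-degree matrix minus adjacency matrix. -/
def WDigraph.lap {N : ℕ} (G : WDigraph N) : Matrix (Fin N) (Fin N) ℝ :=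
  Matrix.diagonal (fun i => ∑ j, G.adj i j) - G.adj

/-- The system `x(t+1) = A x(t) + B u(t)`, with `A` in Jordan form, measured by `N` agents,
`y_i(t) = C_i x(t) ∈ ℝ^{p i}`, that communicate over a weighted digraph. -/
structure Sys where
  J : JordanData
  nu : ℕ
  N : ℕ
  B : Matrix J.Idx (Fin nu) ℝ
  p : Fin N → ℕ
  C : ∀ i, Matrix (Fin (p i)) J.Idx ℝ
  G : WDigraph N

namespace Sys

variable (S : Sys)

/-- `(A, col (C_1, …, C_N))` is detectable. -/
def JointlyDetectable : Prop :=
  IsDetectable S.J.A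
    (Matrix.of fun (q : Σ i : Fin S.N, Fin (S.p i)) (s : S.J.Idx) => S.C q.1 q.2 s)

/-- The block `C_i^{ℓ,h}` of `C_i`. -/
def Cblk (i : Fin S.N) (ℓ : Fin S.J.r) (h : Fin (S.J.g ℓ)) :
    Matrix (Fin (S.p i)) (Fin (S.J.d ℓ h)) ℝ :=
  Matrix.of fun q m => S.C i q ⟨ℓ, h, m⟩

/-- The position, counted from `0`, of the first nonzero column of `C_i^{ℓ,h}`; it is meaningful
(and used) only when `C_i^{ℓ,h} ≠ 0`. -/
def fst (i : Fin S.N) (ℓ : Fin S.J.r) (h : Fin (S.J.g ℓ)) : ℕ :=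
  sInf {m : ℕ | ∃ hm : m < S.J.d ℓ h, (S.Cblk i ℓ h).col ⟨m, hm⟩ ≠ 0}

/-- Miniblocks of `λ_ℓ` that are completely unobservable for agent `i`. -/
def G1 (i : Fin S.N) (ℓ : Fin S.J.r) : Set (Fin (S.J.g ℓ)) := {h | S.Cblk i ℓ h = 0}

/-- Miniblocks of `λ_ℓ` that are partly observable for agent `i`. -/
def G2 (i : Fin S.N) (ℓ : Fin S.J.r) : Set (Fin (S.J.g ℓ)) :=
  {h | S.Cblk i ℓ h ≠ 0 ∧ 0 < S.fst i ℓ h}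

/-- Miniblocks of `λ_ℓ` that are completely observable for agent `i`. -/
def G3 (i : Fin S.N) (ℓ : Fin S.J.r) : Set (Fin (S.J.g ℓ)) :=
  {h | S.Cblk i ℓ h ≠ 0 ∧ S.fst i ℓ h = 0}

theorem fst_lt {i : Fin S.N} {ℓ : Fin S.J.r} {h : Fin (S.J.g ℓ)} (hh : h ∈ S.G2 i ℓ ∪ S.G3 i ℓ) :
    S.fst i ℓ h < S.J.d ℓ h := by
  have h0 : S.Cblk i ℓ h ≠ 0 := hh.elim (fun a => a.1) (fun a => a.1)
  have hne : {m : ℕ | ∃ hm : m < S.J.d ℓ h, (S.Cblk i ℓ h).col ⟨m, hm⟩ ≠ 0}.Nonempty := by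
    by_contra hcon
    apply h0
    ext q m
    by_contra hq
    exact hcon ⟨m, m.2, fun hc => hq (congrFun hc q)⟩
  exact (Nat.sInf_mem hne).1

/-- For every agent `i` and unstable `λ_ℓ`, the first nonzero columns of the nonzero blocks
`C_i^{ℓ,h}` are linearly independent (as a family indexed by `h`). -/
def IndepColumns : Prop :=
  ∀ (i : Fin S.N) (ℓ : Fin S.J.r), 1 ≤ |S.J.eig ℓ| →
    LinearIndependent ℝ fun h : {h : Fin (S.J.g ℓ) // h ∈ S.G2 i ℓ ∪ S.G3 i ℓ} =>
      (S.Cblk i ℓ h.1).col ⟨S.fst i ℓ h.1, S.fst_lt h.2⟩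

/-- Coordinates of `z_{i,d}`: the stable blocks, the completely observable unstable miniblocks and,
in each partly observable one, the entries from the first nonzero column of `C_i^{ℓ,h}` on. -/
def Zd (i : Fin S.N) : Set S.J.Idx :=
  {s | |S.J.eig s.1| < 1 ∨ s.2.1 ∈ S.G3 i s.1 ∨
    (s.2.1 ∈ S.G2 i s.1 ∧ S.fst i s.1 s.2.1 ≤ (s.2.2 : ℕ))}

/-- Coordinates of `x_{i,d}`: the stable blocks and the completely observable miniblocks. -/
def Xd (i : Fin S.N) : Set S.J.Idx :=
  {s | |S.J.eig s.1| < 1 ∨ s.2.1 ∈ S.G3 i s.1}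

/-- Coordinates of `x_{i,u}`: the unstable miniblocks that are completely unobservable or partly
observable for agent `i`. -/
def Xu (i : Fin S.N) : Set S.J.Idx :=
  {s | 1 ≤ |S.J.eig s.1| ∧ s.2.1 ∈ S.G1 i s.1 ∪ S.G2 i s.1}

theorem Xd_subset_Zd (i : Fin S.N) : S.Xd i ⊆ S.Zd i := by
  rintro s (h | h)
  · exact Or.inl h
  · exact Or.inr (Or.inl h)

theorem mem_Xu_of_notMem_Xd {i : Fin S.N} {s : S.J.Idx} (hs : s ∉ S.Xd i) : s ∈ S.Xu i := by
  replace hs : 1 ≤ |S.J.eig s.1| ∧ s.2.1 ∉ S.G3 i s.1 :=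
    ⟨not_lt.1 fun h => hs (Or.inl h), fun h => hs (Or.inr h)⟩
  refine ⟨hs.1, ?_⟩
  by_cases h0 : S.Cblk i s.1 s.2.1 = 0
  · exact Or.inl h0
  · exact Or.inr ⟨h0, Nat.pos_of_ne_zero fun h => hs.2 ⟨h0, h⟩⟩

/-- `F_{i,d}`. -/
def Fd (i : Fin S.N) : Matrix (S.Zd i) (S.Zd i) ℝ := S.J.A.submatrix Subtype.val Subtype.val

/-- `G_{i,d}`. -/
def Gd (i : Fin S.N) : Matrix (S.Zd i) (Fin S.nu) ℝ := S.B.submatrix Subtype.val id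

/-- `H_{i,d}`. -/
def Hd (i : Fin S.N) : Matrix (Fin (S.p i)) (S.Zd i) ℝ := (S.C i).submatrix id Subtype.val

/-- `A_{i,u}`. -/
def Au (i : Fin S.N) : Matrix (S.Xu i) (S.Xu i) ℝ := S.J.A.submatrix Subtype.val Subtype.val

/-- `B_{i,u}`. -/
def Bu (i : Fin S.N) : Matrix (S.Xu i) (Fin S.nu) ℝ := S.B.submatrix Subtype.val id

/-- The design parameters: an output injection `L_{i,d}` for each agent, and one real coupling gain
`k^{ℓ,h}` for each miniblock, common to all agents (the gains of stable miniblocks are not used). -/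
structure Gains where
  L : ∀ i : Fin S.N, Matrix (S.Zd i) (Fin (S.p i)) ℝ
  k : ∀ ℓ : Fin S.J.r, Fin (S.J.g ℓ) → ℝ

variable {S}

/-- `K_i`: the block diagonal matrix with blocks `k^{ℓ,h} I`. -/
def Gains.K (g : S.Gains) (i : Fin S.N) : Matrix (S.Xu i) (S.Xu i) ℝ :=
  Matrix.diagonal fun s => g.k s.1.1 s.1.2.1

/-- The estimate of the whole state that is assembled from the states `z` and `w` of the two local
observers: the entries of `x_{i,d}` are read from `z`, those of `x_{i,u}` are given by `w`. -/
def estimate (i : Fin S.N) (z : S.Zd i → ℝ) (w : S.Xu i → ℝ) : S.J.Idx → ℝ :=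
  fun s => if hs : s ∈ S.Xd i then z ⟨s, S.Xd_subset_Zd i hs⟩ else w ⟨s, S.mem_Xu_of_notMem_Xd hs⟩

/-- `x` is the state trajectory of the system under the input `u`. -/
def IsTrajectory (u : ℕ → Fin S.nu → ℝ) (x : ℕ → S.J.Idx → ℝ) : Prop :=
  ∀ t, x (t + 1) = S.J.A *ᵥ x t + S.B *ᵥ u t

/-- The local Luenberger observer of agent `i`, driven by `u` and `y_i`. -/
def Gains.IsLuenberger (g : S.Gains) (i : Fin S.N) (u : ℕ → Fin S.nu → ℝ)
    (y : ℕ → Fin (S.p i) → ℝ) (z : ℕ → S.Zd i → ℝ) : Prop :=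
  ∀ t, z (t + 1) = S.Fd i *ᵥ z t + S.Gd i *ᵥ u t + g.L i *ᵥ (y t - S.Hd i *ᵥ z t)

/-- The consensus-based observer of agent `i`, where `xh j t` is agent `j`'s estimate of the
whole state at time `t`. -/
def Gains.IsConsensus (g : S.Gains) (i : Fin S.N) (u : ℕ → Fin S.nu → ℝ)
    (xh : Fin S.N → ℕ → S.J.Idx → ℝ) (w : ℕ → S.Xu i → ℝ) : Prop :=
  ∀ t, w (t + 1) = S.Au i *ᵥ w t + S.Bu i *ᵥ u t +
    (g.K i * S.Au i) *ᵥ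
      ∑ j ∈ S.G.nbr i, S.G.adj i j • fun s : S.Xu i => xh j t s.1 - xh i t s.1

/-- With these gains the estimation errors `x - x̂_i` of all agents tend to zero, whatever the
input, the initial state of the system and the initial states of the local observers. -/
def Gains.IsObserver (g : S.Gains) : Prop :=
  ∀ (u : ℕ → Fin S.nu → ℝ) (x : ℕ → S.J.Idx → ℝ)
    (z : ∀ i, ℕ → S.Zd i → ℝ) (w : ∀ i, ℕ → S.Xu i → ℝ),
    IsTrajectory u x →
    (∀ i, g.IsLuenberger i u (fun t => S.C i *ᵥ x t) (z i)) →
    (∀ i, g.IsConsensus i u (fun j t => estimate j (z j t) (w j t)) (w i)) →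
    ∀ i, Tendsto (fun t => x t - estimate i (z i t) (w i t)) atTop (𝓝 0)

variable (S)

/-- The agents for which the miniblock `(ℓ, h)` is completely observable. -/
def V3 (ℓ : Fin S.J.r) (h : Fin (S.J.g ℓ)) : Set (Fin S.N) := {i | h ∈ S.G3 i ℓ}

/-- `L^{ℓ,h}`: the Laplacian without the rows and columns indexed in `V3`. -/
def redLap (ℓ : Fin S.J.r) (h : Fin (S.J.g ℓ)) :
    Matrix {i // i ∉ S.V3 ℓ h} {i // i ∉ S.V3 ℓ h} ℝ :=
  S.G.lap.submatrix Subtype.val Subtype.val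

/-- Index set of the rows of `S^{ℓ,h}`: the pairs (agent `i ∉ V3`, entry `m` of `x^{ℓ,h}`) such that
the entry is unobservable for the agent. -/
abbrev SIdx (ℓ : Fin S.J.r) (h : Fin (S.J.g ℓ)) : Type :=
  {q : {i // i ∉ S.V3 ℓ h} × Fin (S.J.d ℓ h) //
    h ∈ S.G1 q.1.1 ℓ ∨ (h ∈ S.G2 q.1.1 ℓ ∧ (q.2 : ℕ) < S.fst q.1.1 ℓ h)}

/-- The selection matrix `S^{ℓ,h}`: the block diagonal matrix with blocks `I` (agents for which the
miniblock is completely unobservable) and `[I 0]` (agents for which it is partly observable). -/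
def selMat (ℓ : Fin S.J.r) (h : Fin (S.J.g ℓ)) :
    Matrix (S.SIdx ℓ h) ({i // i ∉ S.V3 ℓ h} × Fin (S.J.d ℓ h)) ℝ :=
  (1 : Matrix ({i // i ∉ S.V3 ℓ h} × Fin (S.J.d ℓ h)) _ ℝ).submatrix Subtype.val id

/-- `S^{ℓ,h} (L^{ℓ,h} ⊗ I) (S^{ℓ,h})ᵀ`, the matrix of the condition for the non-augmented
observer. -/
def selLap (ℓ : Fin S.J.r) (h : Fin (S.J.g ℓ)) : Matrix (S.SIdx ℓ h) (S.SIdx ℓ h) ℝ :=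
  S.selMat ℓ h * (S.redLap ℓ h ⊗ₖ (1 : Matrix (Fin (S.J.d ℓ h)) (Fin (S.J.d ℓ h)) ℝ)) *
    (S.selMat ℓ h)ᵀ

end Sys

/-- `k` satisfies `|1 - k μ| < 1 / |a|` for every complex eigenvalue `μ` of `M`. -/
def GainCond {ι : Type} [Fintype ι] (M : Matrix ι ι ℝ) (a k : ℝ) : Prop :=
  ∀ μ ∈ spectrum ℂ (M.map (algebraMap ℝ ℂ)), ‖1 - (k : ℂ) * μ‖ < 1 / |a|

end DistObs

end

/-!
The estimation errors are governed by two kinds of dynamics.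

* On the coordinates `Zd i` the error of the local Luenberger observer obeys the recursion with matrix
  `F_{i,d} - L_{i,d} H_{i,d}`, because `Zd i` is closed under the couplings of `A` and contains every
  coordinate that `C_i` sees (`luenberger_error`).
* On an unstable miniblock `(ℓ, h)`, with gain `k = k^{ℓ,h}`, the errors of the agents outside `V3`
  obey the recursion with matrix `(1 - k L^{ℓ,h}) ⊗ A^{ℓ,h}`, driven by the errors of the agents in
  `V3` (`consensus_error`). The eigenvalues of this matrix are the numbers `λ_ℓ (1 - k μ)`, with `μ`
  an eigenvalue of `L^{ℓ,h}`; hence it is Schur if and only if `k` satisfies the gain condition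
  (`gainCond_iff_isSchur`).

Necessity: with exact local observers, the second recursion runs undriven from arbitrary initial
errors in the first entry of the miniblock (`Gains.IsObserver.gainCond`).

Sufficiency (`isObserver_of_gainCond`) needs output injections `L_{i,d}` that make the first recursion
Schur (`exists_isSchur_Fd_sub`). The independence of the first nonzero columns is the Hautus test for
the pair `(F_{i,d}, H_{i,d})` at the unstable eigenvalues, all of which are real, and such a pair is
stabilized by moving one unstable eigenvalue after the other to zero by rank-one injections
(`exists_isSchur_sub_mul`).

The matrix `S (L^{ℓ,h} ⊗ I) Sᵀ` of the non-augmented condition is block diagonal over the entries of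
the miniblock, and its block for the first entry is `L^{ℓ,h}`, whence the last claim
(`gainCond_redLap_of_selLap`).
-/

namespace DistObs

/-! ### Shifting one eigenvalue by a rank-one update -/

section Shift

variable {K ι : Type} [Field K] [Fintype ι]

theorem eigenvector_of_mem_spectrum {M : Matrix ι ι K} {z : K} (hz : z ∈ spectrum K M) :
    ∃ v : ι → K, v ≠ 0 ∧ M *ᵥ v = z • v := by
  rw [← Matrix.spectrum_toLin', ← Module.End.hasEigenvalue_iff_mem_spectrum] at hz
  obtain ⟨v, hv⟩ := hz.exists_hasEigenvector
  exact ⟨v, hv.2, by simpa using hv.apply_eq_smul⟩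

theorem mem_spectrum_of_eigenvector {M : Matrix ι ι K} {z : K} {v : ι → K} (hv : v ≠ 0)
    (h : M *ᵥ v = z • v) : z ∈ spectrum K M := by
  rw [← Matrix.spectrum_toLin']
  refine Module.End.HasEigenvalue.mem_spectrum ?_
  exact Module.End.hasEigenvalue_of_hasEigenvector (x := v)
    ⟨Module.End.mem_eigenspace_iff.2 (by simpa using h), hv⟩

/-- Subtracting `v wᵀ`, where `M v = a v` and `wᵀ v = a`, moves one root of the characteristic
polynomial from `a` to `0` and leaves the others in place. -/
theorem charpoly_sub_vecMulVec [Infinite K] {M : Matrix ι ι K} {v w : ι → K} {a : K} (hv : v ≠ 0)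
    (h : M *ᵥ v = a • v) (hw : v ⬝ᵥ w = a) :
    (Polynomial.X - Polynomial.C a) * (M - Matrix.vecMulVec v w).charpoly
      = Polynomial.X * M.charpoly := by
  obtain ⟨i, -⟩ := Function.ne_iff.1 hv
  have : Nonempty ι := ⟨i⟩
  have hcard : Fintype.card ι - 1 + 1 = Fintype.card ι := Nat.sub_add_cancel Fintype.card_pos
  have hne : (Polynomial.X - Polynomial.C a) ^ (Fintype.card ι - 1) ≠ 0 :=
    pow_ne_zero _ (Polynomial.X_sub_C_ne_zero a)
  -- compare determinants in `(x - M) ((x - a) + v wᵀ) = (x - a) (x - M + v wᵀ)`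
  refine mul_left_cancel₀ hne (Polynomial.funext fun x => ?_)
  have hprod : (Matrix.scalar ι x - M) * (Matrix.scalar ι (x - a) - Matrix.vecMulVec (-v) w)
      = (x - a) • (Matrix.scalar ι x - (M - Matrix.vecMulVec v w)) := by
    have h1 : (Matrix.scalar ι x - M) * Matrix.vecMulVec v w = (x - a) • Matrix.vecMulVec v w := by
      rw [sub_mul, Matrix.mul_vecMulVec, Matrix.mul_vecMulVec, h, sub_smul, Matrix.smul_vecMulVec]
      congr 1
      rw [← Matrix.smul_vecMulVec]
      congr 1
      ext i
      simp [Matrix.mulVec_diagonal]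
    rw [Matrix.neg_vecMulVec, sub_neg_eq_add, mul_add, h1, Matrix.scalar_apply (x - a),
      ← Matrix.smul_one_eq_diagonal, mul_smul_comm, mul_one, ← smul_add]
    congr 1
    abel
  have hdet := congrArg Matrix.det hprod
  rw [Matrix.det_mul, Matrix.det_smul, ← Matrix.eval_charpoly, ← Matrix.eval_charpoly,
    ← Matrix.eval_charpoly, Matrix.charpoly_vecMulVec, ← hcard] at hdet
  simp only [neg_dotProduct, hw, Polynomial.eval_sub, Polynomial.eval_smul, Polynomial.eval_pow,
    Polynomial.eval_X, smul_eq_mul, Nat.add_sub_cancel] at hdet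
  simp only [Polynomial.eval_mul, Polynomial.eval_pow, Polynomial.eval_sub, Polynomial.eval_X,
    Polynomial.eval_C]
  linear_combination -hdet

end Shift

/-! ### Output injection when the unstable eigenvalues are real -/

section Stabilization

theorem map_mulVec_ofReal {ι κ : Type} [Fintype ι] (M : Matrix κ ι ℝ) (v : ι → ℝ) :
    M.map (algebraMap ℝ ℂ) *ᵥ (fun i => (v i : ℂ)) = fun j => ((M *ᵥ v) j : ℂ) := by
  ext j
  simp [Matrix.mulVec, dotProduct]

variable {ι κ : Type} [Fintype ι] [Fintype κ]

theorem mem_spectrum_of_ofReal_mem_spectrum {M : Matrix ι ι ℝ} {a : ℝ}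
    (h : (a : ℂ) ∈ spectrum ℂ (M.map (algebraMap ℝ ℂ))) : a ∈ spectrum ℝ M := by
  rw [Matrix.mem_spectrum_iff_isRoot_charpoly, Matrix.charpoly_map] at h
  rw [Matrix.mem_spectrum_iff_isRoot_charpoly]
  exact (Polynomial.isRoot_map_iff (algebraMap ℝ ℂ).injective).1 h

/-- Detectability in the sense of the Hautus test gives a stabilizing output injection, if all
unstable eigenvalues are real. They are moved to `0` one after the other: for an unstable
eigenvector `v`, `H v ≠ 0`, so that some `c` has `cᵀ H v` equal to the eigenvalue, and the injection
`v cᵀ` moves it. The Hautus test is not affected by output injections. -/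
theorem exists_isSchur_sub_mul (M : Matrix ι ι ℝ) (H : Matrix κ ι ℝ)
    (hreal : ∀ z ∈ spectrum ℂ (M.map (algebraMap ℝ ℂ)), 1 ≤ ‖z‖ → ∃ a : ℝ, z = a)
    (hobs : ∀ (a : ℝ) (v : ι → ℝ), 1 ≤ |a| → M *ᵥ v = a • v → H *ᵥ v = 0 → v = 0) :
    ∃ L : Matrix ι κ ℝ, IsSchur (M - L * H) := by
  obtain ⟨n, hn⟩ : ∃ n : ℕ,
    ((M.map (algebraMap ℝ ℂ)).charpoly.roots.filter (fun z => 1 ≤ ‖z‖)).card = n := ⟨_, rfl⟩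
  induction n generalizing M with
  | zero =>
    refine ⟨0, fun z hz => ?_⟩
    by_contra hlt
    rw [Multiset.card_eq_zero, Multiset.filter_eq_nil] at hn
    refine hn z ?_ (not_lt.1 hlt)
    rw [Polynomial.mem_roots (Matrix.charpoly_monic _).ne_zero,
      ← Matrix.mem_spectrum_iff_isRoot_charpoly]
    simpa using hz
  | succ n ih =>
    obtain ⟨z, hz⟩ := Multiset.card_pos_iff_exists_mem.1 (by rw [hn]; exact n.succ_pos)
    rw [Multiset.mem_filter, Polynomial.mem_roots (Matrix.charpoly_monic _).ne_zero,
      ← Matrix.mem_spectrum_iff_isRoot_charpoly] at hz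
    obtain ⟨a, rfl⟩ := hreal z hz.1 hz.2
    have ha : 1 ≤ |a| := by simpa using hz.2
    obtain ⟨v, hv0, hv⟩ := eigenvector_of_mem_spectrum (mem_spectrum_of_ofReal_mem_spectrum hz.1)
    have hHv : H *ᵥ v ≠ 0 := fun h0 => hv0 (hobs a v ha hv h0)
    have hHv' : (H *ᵥ v) ⬝ᵥ (H *ᵥ v) ≠ 0 := fun h0 => hHv (dotProduct_self_eq_zero.1 h0)
    -- scaled so that `cᵀ H v = a`
    set c : κ → ℝ := (a / ((H *ᵥ v) ⬝ᵥ (H *ᵥ v))) • (H *ᵥ v) with hc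
    have hcv : v ⬝ᵥ (c ᵥ* H) = a := by
      rw [dotProduct_comm, ← Matrix.dotProduct_mulVec, hc, smul_dotProduct, smul_eq_mul,
        div_mul_cancel₀ _ hHv']
    have hM' : M - Matrix.vecMulVec v c * H = M - Matrix.vecMulVec v (c ᵥ* H) := by
      rw [Matrix.vecMulVec_mul]
    have hchar := charpoly_sub_vecMulVec (M := M.map (algebraMap ℝ ℂ)) (a := (a : ℂ))
      (v := fun i => (v i : ℂ)) (w := fun i => ((c ᵥ* H) i : ℂ))
      (fun h0 => hv0 (funext fun i => by simpa using congrFun h0 i))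
      (by rw [map_mulVec_ofReal, hv]; ext i; simp)
      (by rw [← hcv]; simp [dotProduct])
    have hmap : M.map (algebraMap ℝ ℂ)
        - Matrix.vecMulVec (fun i => (v i : ℂ)) (fun i => ((c ᵥ* H) i : ℂ))
        = (M - Matrix.vecMulVec v c * H).map (algebraMap ℝ ℂ) := by
      rw [hM']
      ext i j
      simp [Matrix.vecMulVec_apply]
    rw [hmap] at hchar
    have hroots := congrArg Polynomial.roots hchar
    rw [Polynomial.roots_mul (mul_ne_zero (Polynomial.X_sub_C_ne_zero _)
        (Matrix.charpoly_monic _).ne_zero),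
      Polynomial.roots_mul (mul_ne_zero Polynomial.X_ne_zero (Matrix.charpoly_monic _).ne_zero),
      Polynomial.roots_X_sub_C, Polynomial.roots_X, Multiset.singleton_add,
      Multiset.singleton_add] at hroots
    obtain ⟨L, hL⟩ := ih (M - Matrix.vecMulVec v c * H)
      (fun z hz hz1 => by
        rw [Matrix.mem_spectrum_iff_isRoot_charpoly,
          ← Polynomial.mem_roots (Matrix.charpoly_monic _).ne_zero] at hz
        have hz' := Multiset.mem_cons_of_mem (b := (a : ℂ)) hz
        rw [hroots] at hz'
        rcases Multiset.mem_cons.1 hz' with rfl | hz'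
        · norm_num at hz1
        · rw [Polynomial.mem_roots (Matrix.charpoly_monic _).ne_zero,
            ← Matrix.mem_spectrum_iff_isRoot_charpoly] at hz'
          exact hreal z hz' hz1)
      (fun b u hb hu hHu => hobs b u hb (by
        rwa [Matrix.sub_mulVec, ← Matrix.mulVec_mulVec, hHu, Matrix.mulVec_zero, sub_zero] at hu)
        hHu)
      (by
        have hf := congrArg (fun s => (Multiset.filter (fun z : ℂ => 1 ≤ ‖z‖) s).card) hroots
        rw [Multiset.filter_cons_of_pos (p := fun z : ℂ => 1 ≤ ‖z‖) _ hz.2,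
          Multiset.filter_cons_of_neg (p := fun z : ℂ => 1 ≤ ‖z‖) _ (by simp),
          Multiset.card_cons, hn] at hf
        exact Nat.succ_injective hf)
    refine ⟨Matrix.vecMulVec v c + L, ?_⟩
    rwa [Matrix.add_mul, ← sub_sub]

end Stabilization

/-! ### Schur matrices and linear recursions -/

section Asymptotics

/-- A nonnegative sequence that is halved every `p` steps, up to a vanishing perturbation, tends to
zero. -/
theorem tendsto_zero_of_le_half_add {a b : ℕ → ℝ} {p : ℕ} (hp : 0 < p) (ha : ∀ t, 0 ≤ a t)
    (h : ∀ t, a (t + p) ≤ a t / 2 + b t) (hb : Tendsto b atTop (𝓝 0)) :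
    Tendsto a atTop (𝓝 0) := by
  rw [Metric.tendsto_atTop]
  intro ε hε
  obtain ⟨T, hT⟩ := Metric.tendsto_atTop.1 hb (ε / 4) (by positivity)
  have hbT : ∀ t, T ≤ t → b t ≤ ε / 4 := fun t ht => by
    have := hT t ht
    rw [Real.dist_eq, sub_zero] at this
    exact (le_abs_self _).trans this.le
  -- the values over one period bound all later ones
  set c : ℝ := ∑ q ∈ Finset.range p, a (T + q) with hc
  have hac : ∀ n, ∀ q < p, a (T + q + n * p) ≤ c * (1 / 2) ^ n + ε / 2 := by
    intro n q hq
    induction n with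
    | zero =>
      have := Finset.single_le_sum (f := fun q => a (T + q)) (fun i _ => ha _)
        (Finset.mem_range.2 hq)
      simp only [zero_mul, add_zero, pow_zero, mul_one]
      linarith
    | succ n ih =>
      have h1 := h (T + q + n * p)
      have h2 := hbT (T + q + n * p) (by omega)
      rw [show T + q + (n + 1) * p = T + q + n * p + p by ring, pow_succ]
      linarith
  have hlim : Tendsto (fun n : ℕ => c * (1 / 2 : ℝ) ^ n) atTop (𝓝 0) := by
    simpa using (tendsto_pow_atTop_nhds_zero_of_lt_one (r := (1 / 2 : ℝ)) (by norm_num)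
      (by norm_num)).const_mul c
  obtain ⟨n₀, hn₀⟩ := Metric.tendsto_atTop.1 hlim (ε / 2) (by positivity)
  refine ⟨T + n₀ * p, fun t ht => ?_⟩
  have hq := Nat.mod_lt (t - T) hp
  have hn : n₀ ≤ (t - T) / p := (Nat.le_div_iff_mul_le hp).2 (by omega)
  have ht' : T + (t - T) % p + (t - T) / p * p = t := by
    have := Nat.mod_add_div' (t - T) p
    omega
  have h1 := hac ((t - T) / p) _ hq
  rw [ht'] at h1
  have h2 := hn₀ _ hn
  rw [Real.dist_eq, sub_zero] at h2 ⊢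
  rw [abs_of_nonneg (ha t)]
  linarith [le_abs_self (c * (1 / 2 : ℝ) ^ ((t - T) / p))]

variable {ι : Type} [Fintype ι]

-- any submultiplicative norm on matrices that is compatible with the one on vectors would do
attribute [local instance] Matrix.linftyOpNormedRing Matrix.linftyOpNormedAlgebra

theorem linfty_opNorm_map_ofReal (M : Matrix ι ι ℝ) : ‖M.map (algebraMap ℝ ℂ)‖ = ‖M‖ := by
  simp [Matrix.linfty_opNorm_def]

/-- By Gelfand's formula. -/
theorem IsSchur.exists_pow_norm_le {M : Matrix ι ι ℝ} (hM : IsSchur M) :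
    ∃ p : ℕ, 0 < p ∧ ‖M ^ p‖ ≤ 1 / 2 := by
  rcases isEmpty_or_nonempty ι with hι | hι
  · refine ⟨1, one_pos, ?_⟩
    rw [Subsingleton.elim (M ^ 1) 0, norm_zero]
    norm_num
  have : CompleteSpace (Matrix ι ι ℂ) := FiniteDimensional.complete ℂ _
  have hrad : spectralRadius ℂ (M.map (algebraMap ℝ ℂ)) < (1 : NNReal) :=
    spectrum.spectralRadius_lt_of_forall_lt _ fun z hz => hM z hz
  obtain ⟨r, hr, hr1⟩ := ENNReal.lt_iff_exists_nnreal_btwn.1 hrad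
  have hev := (spectrum.pow_nnnorm_pow_one_div_tendsto_nhds_spectralRadius
    (M.map (algebraMap ℝ ℂ))).eventually_lt_const hr
  have hr1' : r < 1 := by exact_mod_cast hr1
  have hev2 : ∀ᶠ n : ℕ in atTop, r ^ n < 1 / 2 :=
    (tendsto_pow_atTop_nhds_zero_of_lt_one zero_le hr1').eventually_lt_const (by simp)
  obtain ⟨n, hn, hn2, hn0⟩ := (hev.and (hev2.and (eventually_gt_atTop 0))).exists
  refine ⟨n, hn0, ?_⟩
  have hle : ‖(M.map (algebraMap ℝ ℂ)) ^ n‖₊ ≤ r ^ n := by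
    have h1 := ENNReal.rpow_le_rpow hn.le (Nat.cast_nonneg (α := ℝ) n)
    rw [← ENNReal.rpow_mul, one_div_mul_cancel (by positivity), ENNReal.rpow_one,
      ENNReal.rpow_natCast] at h1
    exact_mod_cast h1
  have hle2 : ‖(M.map (algebraMap ℝ ℂ)) ^ n‖ ≤ 1 / 2 := by
    exact_mod_cast hle.trans hn2.le
  rwa [← Matrix.map_pow, linfty_opNorm_map_ofReal] at hle2

/-- A Schur recursion driven by a vanishing input has vanishing solutions. -/
theorem IsSchur.tendsto_of_forced {M : Matrix ι ι ℝ} (hM : IsSchur M) {x f : ℕ → ι → ℝ}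
    (hx : ∀ t, x (t + 1) = M *ᵥ x t + f t) (hf : Tendsto f atTop (𝓝 0)) :
    Tendsto x atTop (𝓝 0) := by
  obtain ⟨p, hp, hMp⟩ := hM.exists_pow_norm_le
  -- `p` steps of the recursion amount to `M ^ p` and a forcing term that still tends to zero
  have hstep : ∀ n : ℕ, ∃ F : ℕ → ι → ℝ, Tendsto F atTop (𝓝 0) ∧
      ∀ t, x (t + n) = (M ^ n) *ᵥ x t + F t := by
    intro n
    induction n with
    | zero => exact ⟨fun _ => 0, tendsto_const_nhds, fun t => by simp⟩
    | succ n ih =>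
      obtain ⟨F, hF, hxF⟩ := ih
      refine ⟨fun t => M *ᵥ F t + f (t + n), ?_, fun t => ?_⟩
      · have h1 : Tendsto (fun t => M *ᵥ F t) atTop (𝓝 (M *ᵥ 0)) :=
          ((continuous_const.matrix_mulVec continuous_id).tendsto 0).comp hF
        rw [Matrix.mulVec_zero] at h1
        simpa using h1.add ((tendsto_add_atTop_iff_nat n).2 hf)
      · rw [← add_assoc, hx, hxF, Matrix.mulVec_add, Matrix.mulVec_mulVec, ← pow_succ', add_assoc]
  obtain ⟨F, hF, hxF⟩ := hstep p
  rw [tendsto_zero_iff_norm_tendsto_zero]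
  refine tendsto_zero_of_le_half_add hp (fun t => norm_nonneg _) (b := fun t => ‖F t‖)
    (fun t => ?_) (tendsto_zero_iff_norm_tendsto_zero.1 hF)
  rw [hxF]
  refine (norm_add_le _ _).trans (add_le_add_left ?_ _)
  calc ‖M ^ p *ᵥ x t‖ ≤ ‖M ^ p‖ * ‖x t‖ := Matrix.linfty_opNorm_mulVec _ _
    _ ≤ 1 / 2 * ‖x t‖ := by gcongr
    _ = ‖x t‖ / 2 := by ring

/-- The converse of `IsSchur.tendsto_of_forced`, for the recursion without input. -/
theorem isSchur_of_tendsto {M : Matrix ι ι ℝ}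
    (h : ∀ y : ℕ → ι → ℝ, (∀ t, y (t + 1) = M *ᵥ y t) → Tendsto y atTop (𝓝 0)) :
    IsSchur M := by
  intro z hz
  obtain ⟨v, hv0, hv⟩ := eigenvector_of_mem_spectrum hz
  obtain ⟨i, hi⟩ := Function.ne_iff.1 hv0
  have hpow : ∀ t : ℕ, ((M ^ t).map (algebraMap ℝ ℂ)) *ᵥ v = z ^ t • v := by
    intro t
    induction t with
    | zero => ext i; simp [Matrix.map_one]
    | succ t ih =>
      rw [pow_succ, Matrix.map_mul, ← Matrix.mulVec_mulVec, hv, Matrix.mulVec_smul, ih, smul_smul,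
        pow_succ']
  -- the entries of `M ^ t` tend to zero, hence so does `z ^ t * v i`
  have hent : ∀ j, Tendsto (fun t : ℕ => (M ^ t) i j) atTop (𝓝 0) := fun j => by
    have := tendsto_pi_nhds.1 (h (fun t => (M ^ t) *ᵥ Pi.single j 1)
      fun t => by rw [Matrix.mulVec_mulVec, ← pow_succ']) i
    simpa [Matrix.mulVec_single_one] using this
  have hlim : Tendsto (fun t : ℕ => z ^ t * v i) atTop (𝓝 0) := by
    have h1 : Tendsto (fun t : ℕ => ∑ j, (((M ^ t) i j : ℝ) : ℂ) * v j) atTop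
        (𝓝 (∑ j, ((0 : ℝ) : ℂ) * v j)) :=
      tendsto_finsetSum _ fun j _ =>
        ((Complex.continuous_ofReal.tendsto 0).comp (hent j)).mul_const _
    simp only [Complex.ofReal_zero, zero_mul, Finset.sum_const_zero] at h1
    refine h1.congr fun t => ?_
    simpa [Matrix.mulVec, dotProduct] using congrFun (hpow t) i
  have hz0 : Tendsto (fun t : ℕ => ‖z‖ ^ t) atTop (𝓝 0) := by
    have hi' : ‖v i‖ ≠ 0 := norm_ne_zero_iff.2 hi
    have h2 := (hlim.norm.div_const ‖v i‖)
    simp only [norm_mul, norm_pow, norm_zero, zero_div, mul_div_cancel_right₀ _ hi'] at h2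
    exact h2
  simpa using tendsto_pow_atTop_nhds_zero_iff.1 hz0

end Asymptotics

/-! ### The gain condition as a Schur condition -/

section Gain

variable {ι : Type} [Fintype ι]

/-- The eigenvalues of `a (1 - k M)` are the numbers `a (1 - k μ)`, with `μ` an eigenvalue of `M`.
The decidability instance is arbitrary, because `1` depends on it and the index types to which this
is applied carry one of their own. -/
theorem gainCond_iff_isSchur [inst : DecidableEq ι] {M : Matrix ι ι ℝ} {a k : ℝ} (ha : 1 ≤ |a|) :
    GainCond M a k ↔ IsSchur (a • (1 - k • M)) := by
  obtain rfl : inst = fun i j => Classical.propDecidable (i = j) := Subsingleton.elim _ _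
  rcases isEmpty_or_nonempty ι with hι | hι
  · exact ⟨fun _ z hz => by simp at hz, fun _ z hz => by simp at hz⟩
  have hmap : (a • (1 - k • M)).map (algebraMap ℝ ℂ) = Polynomial.aeval (M.map (algebraMap ℝ ℂ))
      (Polynomial.C (a : ℂ) * (1 - Polynomial.C (k : ℂ) * Polynomial.X)) := by
    simp only [map_mul, map_sub, map_one, Polynomial.aeval_C, Polynomial.aeval_X,
      ← Algebra.smul_def]
    ext i j
    simp [Matrix.one_apply, apply_ite]
  have hspec : spectrum ℂ ((a • (1 - k • M)).map (algebraMap ℝ ℂ))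
      = (fun μ : ℂ => a * (1 - k * μ)) '' spectrum ℂ (M.map (algebraMap ℝ ℂ)) := by
    rw [hmap, spectrum.map_polynomial_aeval_of_nonempty _ _
      (spectrum.nonempty_of_isAlgClosed_of_finiteDimensional ℂ _)]
    simp
  have ha0 : 0 < |a| := one_pos.trans_le ha
  simp only [GainCond, IsSchur, hspec, Set.forall_mem_image]
  refine forall₂_congr fun μ _ => ?_
  rw [lt_div_iff₀ ha0, norm_mul, Complex.norm_real, Real.norm_eq_abs, mul_comm]

end Gain

/-! ### Matrices in Jordan form -/

section Jordan

variable (J : JordanData)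

theorem JordanData.A_apply_same (ℓ : Fin J.r) (h : Fin (J.g ℓ)) (m m' : Fin (J.d ℓ h)) :
    J.A ⟨ℓ, h, m⟩ ⟨ℓ, h, m'⟩ =
      if m = m' then J.eig ℓ else if (m : ℕ) + 1 = (m' : ℕ) then 1 else 0 := by
  simp [JordanData.A, miniblock]

/-- `A` couples a coordinate only to later or equal ones of its own miniblock. -/
theorem JordanData.A_apply_ne_zero {s s' : J.Idx} (hs : J.A s s' ≠ 0) :
    ∃ m' : Fin (J.d s.1 s.2.1), s' = ⟨s.1, s.2.1, m'⟩ ∧ (s.2.2 : ℕ) ≤ m' := by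
  obtain ⟨ℓ, h, m⟩ := s
  obtain ⟨ℓ', h', m'⟩ := s'
  by_cases hℓ : ℓ = ℓ'
  · subst hℓ
    by_cases hh : h = h'
    · subst hh
      refine ⟨m', rfl, ?_⟩
      by_contra hlt
      rw [J.A_apply_same, if_neg (by rintro rfl; exact hlt le_rfl),
        if_neg (by simp only at hlt; omega)] at hs
      exact hs rfl
    · exact (hs (by
        rw [JordanData.A, Matrix.blockDiagonal'_apply_eq,
          Matrix.blockDiagonal'_apply_ne _ _ _ hh])).elim
  · exact (hs (by rw [JordanData.A, Matrix.blockDiagonal'_apply_ne _ _ _ hℓ])).elim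

/-- The rows of `A`, with coefficients mapped to a ring `R`; used for `R = ℝ` and `R = ℂ`. -/
theorem JordanData.sum_A_mul {R : Type} [CommRing R] (φ : ℝ →+* R) (f : J.Idx → R)
    (ℓ : Fin J.r) (h : Fin (J.g ℓ)) (m : Fin (J.d ℓ h)) :
    ∑ s', φ (J.A ⟨ℓ, h, m⟩ s') * f s' = φ (J.eig ℓ) * f ⟨ℓ, h, m⟩ +
      if hm : (m : ℕ) + 1 < J.d ℓ h then f ⟨ℓ, h, ⟨m + 1, hm⟩⟩ else 0 := by
  have hzero : ∀ s' : J.Idx, s' ≠ ⟨ℓ, h, m⟩ →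
      (∀ hm : (m : ℕ) + 1 < J.d ℓ h, s' ≠ ⟨ℓ, h, ⟨m + 1, hm⟩⟩) → φ (J.A ⟨ℓ, h, m⟩ s') = 0 := by
    intro s' h1 h2
    by_contra hs
    obtain ⟨m', rfl, -⟩ := J.A_apply_ne_zero fun h0 => hs (by rw [h0, map_zero])
    refine hs ?_
    rw [J.A_apply_same, if_neg (by rintro rfl; exact h1 rfl), if_neg, map_zero]
    intro hm
    exact h2 (hm ▸ m'.2) (by simp only [hm])
  split_ifs with hm
  · rw [Fintype.sum_eq_add (⟨ℓ, h, m⟩ : J.Idx) ⟨ℓ, h, ⟨m + 1, hm⟩⟩]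
    · rw [J.A_apply_same, J.A_apply_same, if_pos rfl, if_neg, if_pos rfl, map_one, one_mul]
      intro h0
      simpa using congrArg Fin.val h0
    · intro h0
      simp only [Sigma.mk.injEq, heq_eq_eq, true_and] at h0
      simpa using congrArg Fin.val h0
    · rintro s' ⟨h1, h2⟩
      rw [hzero s' h1 fun _ => h2, zero_mul]
  · rw [Fintype.sum_eq_single (⟨ℓ, h, m⟩ : J.Idx), J.A_apply_same, if_pos rfl, add_zero]
    intro s' h1
    rw [hzero s' h1 fun hm' => (hm hm').elim, zero_mul]

theorem JordanData.A_mulVec (f : J.Idx → ℝ) (ℓ : Fin J.r) (h : Fin (J.g ℓ)) (m : Fin (J.d ℓ h)) :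
    (J.A *ᵥ f) ⟨ℓ, h, m⟩ = J.eig ℓ * f ⟨ℓ, h, m⟩ +
      if hm : (m : ℕ) + 1 < J.d ℓ h then f ⟨ℓ, h, ⟨m + 1, hm⟩⟩ else 0 :=
  J.sum_A_mul (RingHom.id ℝ) f ℓ h m

end Jordan

/-! ### The observable and unobservable coordinates of an agent -/

theorem sum_subtype_eq_sum {ι R : Type} [Fintype ι] [AddCommMonoid R] (Q : Set ι) [Fintype Q]
    (f : ι → R) (hf : ∀ s ∉ Q, f s = 0) : ∑ s : Q, f s = ∑ s, f s := by
  rw [← Finset.sum_subtype (Finset.univ.filter (· ∈ Q)) (by simp) f]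
  exact Finset.sum_subset (Finset.subset_univ _) fun s _ hs => hf s (by simpa using hs)

theorem submatrix_mulVec_apply {ι κ κ' : Type} [Fintype ι] (M : Matrix κ ι ℝ) (Q : Set ι)
    [Fintype Q] (e : κ' → κ) (f : ι → ℝ) (r : κ') (hQ : ∀ s ∉ Q, M (e r) s = 0) :
    (M.submatrix e (Subtype.val : Q → ι) *ᵥ fun s => f s) r = (M *ᵥ f) (e r) :=
  sum_subtype_eq_sum Q (fun s => M (e r) s * f s) fun s hs => by rw [hQ s hs, zero_mul]

namespace Sys

variable {S : Sys}

theorem mem_Zd_of_A_ne_zero {i : Fin S.N} {s s' : S.J.Idx} (hs : s ∈ S.Zd i)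
    (h : S.J.A s s' ≠ 0) : s' ∈ S.Zd i := by
  obtain ⟨m', rfl, hm⟩ := S.J.A_apply_ne_zero h
  exact hs.imp id (Or.imp id fun h2 => ⟨h2.1, h2.2.trans hm⟩)

theorem mem_Xu_of_A_ne_zero {i : Fin S.N} {s s' : S.J.Idx} (hs : s ∈ S.Xu i)
    (h : S.J.A s s' ≠ 0) : s' ∈ S.Xu i := by
  obtain ⟨m', rfl, -⟩ := S.J.A_apply_ne_zero h
  exact hs

theorem notMem_Xd_of_mem_Xu {i : Fin S.N} {s : S.J.Idx} (hs : s ∈ S.Xu i) : s ∉ S.Xd i := by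
  rintro (h | h)
  · exact absurd hs.1 (not_le.2 h)
  · rcases hs.2 with h1 | h2
    · exact h.1 h1
    · exact h2.2.ne' h.2

theorem C_eq_zero_of_notMem_Zd {i : Fin S.N} {s : S.J.Idx} (hs : s ∉ S.Zd i) (q : Fin (S.p i)) :
    S.C i q s = 0 := by
  have hs3 : s.2.1 ∉ S.G3 i s.1 := fun h => hs (Or.inr (Or.inl h))
  by_cases h0 : S.Cblk i s.1 s.2.1 = 0
  · exact congrFun (congrFun h0 q) s.2.2
  · have h2 : s.2.1 ∈ S.G2 i s.1 := ⟨h0, Nat.pos_of_ne_zero fun h => hs3 ⟨h0, h⟩⟩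
    have hlt : (s.2.2 : ℕ) < S.fst i s.1 s.2.1 := not_le.1 fun h => hs (Or.inr (Or.inr ⟨h2, h⟩))
    have hnot := Nat.notMem_of_lt_sInf hlt
    by_contra hne
    exact hnot ⟨s.2.2.2, fun hc => hne (congrFun hc q)⟩

theorem Fd_mulVec (i : Fin S.N) (f : S.J.Idx → ℝ) (s : S.Zd i) :
    (S.Fd i *ᵥ fun s => f s) s = (S.J.A *ᵥ f) s :=
  submatrix_mulVec_apply _ _ _ _ _ fun _ hs' => by_contra fun h => hs' (mem_Zd_of_A_ne_zero s.2 h)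

theorem Hd_mulVec (i : Fin S.N) (f : S.J.Idx → ℝ) :
    (S.Hd i *ᵥ fun s => f s) = S.C i *ᵥ f :=
  funext fun q => submatrix_mulVec_apply _ _ id _ _ fun _ hs' => C_eq_zero_of_notMem_Zd hs' q

theorem Au_mulVec (i : Fin S.N) (f : S.J.Idx → ℝ) (s : S.Xu i) :
    (S.Au i *ᵥ fun s => f s) s = (S.J.A *ᵥ f) s :=
  submatrix_mulVec_apply _ _ _ _ _ fun _ hs' => by_contra fun h => hs' (mem_Xu_of_A_ne_zero s.2 h)

/-! ### Detectability of the local pairs -/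

section LocalDetectability

/-- An eigenvector `V` of the restriction of `A` to `Zd i`, extended by zero, vanishes on the blocks of
the other eigenvalues. -/
theorem eq_zero_of_eigenvector {R : Type} [Field R] (φ : ℝ →+* R) {i : Fin S.N} {z : R}
    {V : S.J.Idx → R} (hV : ∀ s ∉ S.Zd i, V s = 0)
    (hz : ∀ s ∈ S.Zd i, ∑ s', φ (S.J.A s s') * V s' = z * V s) (s : S.J.Idx)
    (hs : φ (S.J.eig s.1) ≠ z) : V s = 0 := by
  obtain ⟨ℓ, h, m⟩ := s
  obtain ⟨n, hn⟩ : ∃ n, S.J.d ℓ h - m = n := ⟨_, rfl⟩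
  induction n using Nat.strong_induction_on generalizing m with
  | _ n ih =>
    by_cases hmem : (⟨ℓ, h, m⟩ : S.J.Idx) ∈ S.Zd i
    · have h1 := hz _ hmem
      have h2 : (if hm : (m : ℕ) + 1 < S.J.d ℓ h then V ⟨ℓ, h, ⟨m + 1, hm⟩⟩ else 0) = 0 := by
        split_ifs with hm
        · exact ih (S.J.d ℓ h - (m + 1)) (by omega) ⟨m + 1, hm⟩ hs rfl
        · rfl
      rw [S.J.sum_A_mul, h2, add_zero] at h1
      by_contra h0
      exact hs (mul_right_cancel₀ h0 h1)
    · exact hV _ hmem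

theorem sum_A_mul_extend {R : Type} [Field R] (φ : ℝ →+* R) {i : Fin S.N} {z : R}
    {v : S.Zd i → R} (hv : (S.Fd i).map φ *ᵥ v = z • v) :
    ∀ s ∈ S.Zd i, ∑ s', φ (S.J.A s s') * (if hs : s' ∈ S.Zd i then v ⟨s', hs⟩ else 0)
      = z * (if hs : s ∈ S.Zd i then v ⟨s, hs⟩ else 0) := by
  intro s hs
  rw [dif_pos hs, ← sum_subtype_eq_sum (S.Zd i)]
  · refine Eq.trans ?_ (congrFun hv ⟨s, hs⟩)
    exact Finset.sum_congr rfl fun s' _ => by simp [Fd]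
  · intro s' hs'
    rw [dif_neg hs', mul_zero]

/-- The local pair `(F_{i,d}, H_{i,d})` admits a stabilizing output injection. An eigenvector of
`F_{i,d}` for an unstable `a` lives on the leading entries of the observable parts of the blocks
of `a`, which `H_{i,d}` maps to a combination of the first nonzero columns of the `C_i^{ℓ,h}`; these
are independent. -/
theorem exists_isSchur_Fd_sub (hind : S.IndepColumns) (i : Fin S.N) :
    ∃ L : Matrix (S.Zd i) (Fin (S.p i)) ℝ, IsSchur (S.Fd i - L * S.Hd i) := by
  refine exists_isSchur_sub_mul _ _ (fun z hz _ => ?_) (fun a v ha hv hHv => ?_)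
  · obtain ⟨v, hv0, hv⟩ := eigenvector_of_mem_spectrum hz
    obtain ⟨s, hs⟩ := Function.ne_iff.1 hv0
    refine ⟨S.J.eig s.1.1, by_contra fun hne => hs ?_⟩
    have := eq_zero_of_eigenvector (algebraMap ℝ ℂ)
      (V := fun s => if hs : s ∈ S.Zd i then v ⟨s, hs⟩ else 0) (fun s hs => dif_neg hs)
      (sum_A_mul_extend _ hv) s.1 (fun h => hne h.symm)
    rwa [dif_pos s.2] at this
  · set V : S.J.Idx → ℝ := fun s => if hs : s ∈ S.Zd i then v ⟨s, hs⟩ else 0 with hVdef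
    have hVv : ∀ s : S.Zd i, V s = v s := fun s => dif_pos s.2
    have hV0 : ∀ s ∉ S.Zd i, V s = 0 := fun s hs => dif_neg hs
    have hV : ∀ s ∈ S.Zd i, ∑ s', S.J.A s s' * V s' = a * V s :=
      sum_A_mul_extend (RingHom.id ℝ) hv
    have hVeig : ∀ s, S.J.eig s.1 ≠ a → V s = 0 := fun s hs =>
      eq_zero_of_eigenvector (RingHom.id ℝ) hV0 hV s hs
    suffices h : ∀ s, V s = 0 from funext fun s => (hVv s).symm.trans (h s)
    rintro ⟨ℓ, h, m⟩
    by_cases hℓ : S.J.eig ℓ = a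
    swap
    · exact hVeig _ hℓ
    -- only the first entry of each observable part of a block survives
    have hnext : ∀ (h : Fin (S.J.g ℓ)) (m m' : Fin (S.J.d ℓ h)), (m : ℕ) + 1 = m' →
        (⟨ℓ, h, m⟩ : S.J.Idx) ∈ S.Zd i → V ⟨ℓ, h, m'⟩ = 0 := by
      intro h m m' hm hmem
      have h1 := hV _ hmem
      have h2 : (m : ℕ) + 1 < S.J.d ℓ h := hm ▸ m'.2
      have h3 := S.J.sum_A_mul (RingHom.id ℝ) V ℓ h m
      simp only [RingHom.id_apply] at h3
      rw [h3, dif_pos h2, hℓ, add_eq_left] at h1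
      rw [← h1]
      congr
      exact Fin.ext hm.symm
    have hsupp : ∀ (h : Fin (S.J.g ℓ)) (m : Fin (S.J.d ℓ h)), V ⟨ℓ, h, m⟩ ≠ 0 →
        h ∈ S.G2 i ℓ ∪ S.G3 i ℓ ∧ (m : ℕ) = S.fst i ℓ h := by
      intro h m hne
      have hmem : (⟨ℓ, h, m⟩ : S.J.Idx) ∈ S.Zd i := by_contra fun h0 => hne (hV0 _ h0)
      rcases hmem with hst | h3 | h2
      · exact absurd (hℓ ▸ hst) (not_lt.2 ha)
      · refine ⟨Or.inr h3, ?_⟩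
        rw [h3.2]
        by_contra hm0
        exact hne (hnext h ⟨m - 1, by omega⟩ m (by simp only; omega) (Or.inr (Or.inl h3)))
      · refine ⟨Or.inl h2.1, ?_⟩
        have hle : S.fst i ℓ h ≤ m := h2.2
        by_contra hm0
        exact hne (hnext h ⟨m - 1, by omega⟩ m (by simp only; omega)
          (Or.inr (Or.inr ⟨h2.1, by simp only; omega⟩)))
    have hCV : S.C i *ᵥ V = 0 := by
      rw [← Hd_mulVec, ← hHv]
      congr 1
      exact funext hVv
    have hli := Fintype.linearIndependent_iff.1 (hind i ℓ (hℓ ▸ ha))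
      (fun h => V ⟨ℓ, h.1, ⟨S.fst i ℓ h.1, S.fst_lt h.2⟩⟩) (by
        rw [← hCV]
        ext q
        rw [Finset.sum_apply, Matrix.mulVec, dotProduct, Fintype.sum_sigma,
          Fintype.sum_eq_single ℓ, Fintype.sum_sigma]
        · rw [← sum_subtype_eq_sum (S.G2 i ℓ ∪ S.G3 i ℓ)]
          · refine Finset.sum_congr rfl fun h _ => ?_
            rw [Fintype.sum_eq_single ⟨S.fst i ℓ h.1, S.fst_lt h.2⟩]
            · simp [Cblk, mul_comm]
            · intro m hm
              by_cases hz : V ⟨ℓ, h.1, m⟩ = 0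
              · rw [hz, mul_zero]
              · exact (hm (Fin.ext (hsupp _ _ hz).2)).elim
          · intro h hh
            refine Finset.sum_eq_zero fun m _ => ?_
            by_cases hz : V ⟨ℓ, h, m⟩ = 0
            · rw [hz, mul_zero]
            · exact (hh (hsupp _ _ hz).1).elim
        · intro ℓ' hℓ'
          refine Finset.sum_eq_zero fun s _ => ?_
          rw [hVeig ⟨ℓ', s⟩ fun h0 => hℓ' (S.J.eig_injective (h0.trans hℓ.symm)), mul_zero])
    by_contra hne
    obtain ⟨hmem, hm⟩ := hsupp h m hne
    refine hne ?_
    rw [← hli ⟨h, hmem⟩]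
    congr
    exact Fin.ext hm

end LocalDetectability

end Sys

/-! ### The estimation error -/

/-- The diffusive coupling of the agents is minus the Laplacian. -/
theorem WDigraph.sum_nbr {N : ℕ} (G : WDigraph N) (i : Fin N) (y : Fin N → ℝ) :
    ∑ j ∈ G.nbr i, G.adj i j * (y j - y i) = -∑ j, G.lap i j * y j := by
  have h1 : ∑ j ∈ G.nbr i, G.adj i j * (y j - y i) = ∑ j, G.adj i j * (y j - y i) := by
    refine Finset.sum_subset (Finset.subset_univ _) fun j _ hj => ?_
    have h0 : ¬0 < G.adj i j := by simpa [WDigraph.nbr] using hj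
    rw [le_antisymm (not_lt.1 h0) (G.adj_nonneg i j), zero_mul]
  rw [h1]
  simp only [WDigraph.lap, Matrix.sub_apply, Matrix.diagonal_apply, sub_mul, mul_sub, ite_mul,
    zero_mul, Finset.sum_sub_distrib, Finset.sum_ite_eq, Finset.mem_univ, if_true, Finset.sum_mul]
  ring

theorem WDigraph.sum_lap {N : ℕ} (G : WDigraph N) (i : Fin N) : ∑ j, G.lap i j = 0 := by
  simpa using (G.sum_nbr i fun _ => 1).symm

namespace Sys

variable {S : Sys}

/-- The coupling term of the consensus observer, on the coordinates of `x_{i,u}`. The gain leaves the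
matrix because it is constant on the miniblocks. -/
theorem consensus_term (g : S.Gains) (i : Fin S.N) (y : Fin S.N → S.J.Idx → ℝ) (s : S.Xu i) :
    ((g.K i * S.Au i) *ᵥ
      ∑ j ∈ S.G.nbr i, S.G.adj i j • fun s : S.Xu i => y j s.1 - y i s.1) s
      = -(g.k s.1.1 s.1.2.1 * (S.J.A *ᵥ fun s' => ∑ j, S.G.lap i j * y j s') s) := by
  have h1 : (∑ j ∈ S.G.nbr i, S.G.adj i j • fun s : S.Xu i => y j s.1 - y i s.1)
      = fun s : S.Xu i => (-fun s' => ∑ j, S.G.lap i j * y j s') s.1 := by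
    ext s'
    simp only [Finset.sum_apply, Pi.smul_apply, smul_eq_mul, Pi.neg_apply]
    exact S.G.sum_nbr i fun j => y j s'
  rw [h1, ← Matrix.mulVec_mulVec, Gains.K, Matrix.mulVec_diagonal, Au_mulVec, Matrix.mulVec_neg,
    Pi.neg_apply, mul_neg]

theorem luenberger_error {g : S.Gains} {i : Fin S.N} {u : ℕ → Fin S.nu → ℝ}
    {x : ℕ → S.J.Idx → ℝ} {z : ℕ → S.Zd i → ℝ} (hx : IsTrajectory u x)
    (hz : g.IsLuenberger i u (fun t => S.C i *ᵥ x t) z) (t : ℕ) :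
    (fun s : S.Zd i => x (t + 1) s - z (t + 1) s)
      = (S.Fd i - g.L i * S.Hd i) *ᵥ fun s => x t s - z t s := by
  have hsub : (fun s : S.Zd i => x t s - z t s) = (fun s : S.Zd i => x t s) - z t := rfl
  have hB : ∀ s : S.Zd i, (S.B *ᵥ u t) s = (S.Gd i *ᵥ u t) s := fun s => rfl
  ext s
  rw [hx t, hz t, hsub, Matrix.sub_mulVec, ← Matrix.mulVec_mulVec, Matrix.mulVec_sub (S.Fd i),
    Matrix.mulVec_sub (S.Hd i), Hd_mulVec]
  simp only [Pi.add_apply, Pi.sub_apply, Fd_mulVec, hB]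
  ring

/-- The error of agent `i` on `x_{i,u}`: the estimates `xh` in the coupling term can be replaced by the
errors because the rows of the Laplacian sum to zero. -/
theorem consensus_error {g : S.Gains} {i : Fin S.N} {u : ℕ → Fin S.nu → ℝ}
    {x : ℕ → S.J.Idx → ℝ} {xh : Fin S.N → ℕ → S.J.Idx → ℝ} {w : ℕ → S.Xu i → ℝ}
    (hx : IsTrajectory u x) (hw : g.IsConsensus i u xh w)
    (hxh : ∀ t, ∀ s : S.Xu i, xh i t s = w t s) (t : ℕ) {s : S.J.Idx} (hs : s ∈ S.Xu i) :
    x (t + 1) s - xh i (t + 1) s = (S.J.A *ᵥ fun s' => (x t s' - xh i t s')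
      - g.k s.1 s.2.1 * ∑ j, S.G.lap i j * (x t s' - xh j t s')) s := by
  have hB : (S.B *ᵥ u t) s = (S.Bu i *ᵥ u t) ⟨s, hs⟩ := rfl
  have hwt : w t = fun s : S.Xu i => xh i t s := funext fun s => (hxh t s).symm
  have hlap : (fun s' => (x t s' - xh i t s')
      - g.k s.1 s.2.1 * ∑ j, S.G.lap i j * (x t s' - xh j t s'))
      = x t - xh i t + g.k s.1 s.2.1 • fun s' => ∑ j, S.G.lap i j * xh j t s' := by
    ext s'
    simp only [mul_sub, Finset.sum_sub_distrib, ← Finset.sum_mul, S.G.sum_lap i, Pi.add_apply,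
      Pi.sub_apply, Pi.smul_apply, smul_eq_mul]
    ring
  rw [hxh (t + 1) ⟨s, hs⟩, hw t, hx t, hlap, Matrix.mulVec_add, Matrix.mulVec_smul,
    Matrix.mulVec_sub]
  simp only [Pi.add_apply, Pi.sub_apply, Pi.smul_apply, smul_eq_mul]
  rw [consensus_term g i (fun j => xh j t) ⟨s, hs⟩, hwt, Au_mulVec, hB]
  ring

theorem mem_Xu_of_notMem_V3 {i : Fin S.N} {ℓ : Fin S.J.r} {h : Fin (S.J.g ℓ)}
    (hℓ : 1 ≤ |S.J.eig ℓ|) (hi : i ∉ S.V3 ℓ h) (m : Fin (S.J.d ℓ h)) :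
    (⟨ℓ, h, m⟩ : S.J.Idx) ∈ S.Xu i :=
  S.mem_Xu_of_notMem_Xd fun hs => hs.elim (fun h => absurd h (not_lt.2 hℓ)) hi

/-! ### Sufficiency and necessity of the gain condition -/

/-- The local observers converge, so that all errors on `x_{i,d}` vanish. In an unstable miniblock the
errors of the other agents are treated entry by entry, from the last one to the first one: the
errors in the `m`-th entry obey a recursion with the Schur matrix `λ (1 - k L^{ℓ,h})`, driven by the
errors in the next entry and by those of the agents in `V3`. -/
theorem isObserver_of_gainCond {g : S.Gains} (hL : ∀ i, IsSchur (S.Fd i - g.L i * S.Hd i))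
    (hk : ∀ ℓ, 1 ≤ |S.J.eig ℓ| → ∀ h, GainCond (S.redLap ℓ h) (S.J.eig ℓ) (g.k ℓ h)) :
    g.IsObserver := by
  intro u x z w hx hz hw
  set e : Fin S.N → ℕ → S.J.Idx → ℝ := fun i t => x t - estimate i (z i t) (w i t) with he
  have hd : ∀ i, ∀ s ∈ S.Xd i, Tendsto (fun t => e i t s) atTop (𝓝 0) := by
    intro i s hs
    have h1 : Tendsto (fun t => fun s : S.Zd i => x t s - z i t s) atTop (𝓝 0) :=
      (hL i).tendsto_of_forced (f := fun _ => 0)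
        (fun t => by rw [add_zero]; exact luenberger_error hx (hz i) t) tendsto_const_nhds
    refine (tendsto_pi_nhds.1 h1 ⟨s, S.Xd_subset_Zd i hs⟩).congr fun t => ?_
    simp [he, estimate, dif_pos hs]
  have hu : ∀ ℓ, 1 ≤ |S.J.eig ℓ| → ∀ h (m : Fin (S.J.d ℓ h)) (i : Fin S.N),
      Tendsto (fun t => e i t ⟨ℓ, h, m⟩) atTop (𝓝 0) := by
    intro ℓ hℓ h m
    obtain ⟨n, hn⟩ : ∃ n, S.J.d ℓ h - m = n := ⟨_, rfl⟩
    induction n using Nat.strong_induction_on generalizing m with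
    | _ n ih =>
      have h3 : ∀ i ∈ S.V3 ℓ h, Tendsto (fun t => e i t ⟨ℓ, h, m⟩) atTop (𝓝 0) :=
        fun i hi => hd i _ (Or.inr hi)
      -- the error in the entry that follows in the miniblock, known to vanish by induction
      set nx : Fin S.N → ℕ → ℝ := fun i t =>
        if hm : (m : ℕ) + 1 < S.J.d ℓ h then e i t ⟨ℓ, h, ⟨m + 1, hm⟩⟩ else 0 with hnx
      have hnx0 : ∀ i, Tendsto (nx i) atTop (𝓝 0) := by
        intro i
        by_cases hm : (m : ℕ) + 1 < S.J.d ℓ h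
        · simp only [hnx, dif_pos hm]
          exact ih (S.J.d ℓ h - (m + 1)) (by omega) ⟨m + 1, hm⟩ rfl i
        · simp only [hnx, dif_neg hm]
          exact tendsto_const_nhds
      have hstep : ∀ i ∉ S.V3 ℓ h, ∀ t, e i (t + 1) ⟨ℓ, h, m⟩
          = S.J.eig ℓ * (e i t ⟨ℓ, h, m⟩ - g.k ℓ h * ∑ j, S.G.lap i j * e j t ⟨ℓ, h, m⟩)
            + (nx i t - g.k ℓ h * ∑ j, S.G.lap i j * nx j t) := by
        intro i hi t
        have h1 := consensus_error hx (hw i) (fun t s => by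
          simp only [estimate]
          rw [dif_neg (notMem_Xd_of_mem_Xu s.2)]) t (mem_Xu_of_notMem_V3 hℓ hi m)
        rw [S.J.A_mulVec] at h1
        refine h1.trans ?_
        congr 1
        by_cases hm : (m : ℕ) + 1 < S.J.d ℓ h
        · simp only [hnx, dif_pos hm]
          rfl
        · simp only [hnx, dif_neg hm]
          simp
      have hM := (gainCond_iff_isSchur hℓ).1 (hk ℓ hℓ h)
      have hlim : Tendsto (fun t => fun i : {i // i ∉ S.V3 ℓ h} => e i.1 t ⟨ℓ, h, m⟩) atTop
          (𝓝 0) := by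
        refine hM.tendsto_of_forced (f := fun t => fun i =>
          -(S.J.eig ℓ * (g.k ℓ h * ∑ j : {j // ¬j ∉ S.V3 ℓ h}, S.G.lap i j * e j t ⟨ℓ, h, m⟩))
            + (nx i t - g.k ℓ h * ∑ j, S.G.lap i j * nx j t)) (fun t => ?_) ?_
        · ext i
          rw [hstep i.1 i.2, ← Fintype.sum_subtype_add_sum_subtype (fun j => j ∉ S.V3 ℓ h)]
          have hred : (S.redLap ℓ h *ᵥ fun i => e i.1 t ⟨ℓ, h, m⟩) i
              = ∑ j : {j // j ∉ S.V3 ℓ h}, S.G.lap i j * e j t ⟨ℓ, h, m⟩ := rfl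
          simp only [Pi.add_apply, Matrix.smul_mulVec, Matrix.sub_mulVec, Matrix.one_mulVec,
            Pi.smul_apply, Pi.sub_apply, smul_eq_mul, hred]
          ring
        · rw [tendsto_pi_nhds]
          intro i
          have t1 : Tendsto (fun t => ∑ j : {j // ¬j ∉ S.V3 ℓ h},
              S.G.lap i j * e j t ⟨ℓ, h, m⟩) atTop (𝓝 0) := by
            simpa using tendsto_finsetSum Finset.univ
              fun (j : {j // ¬j ∉ S.V3 ℓ h}) _ => (h3 j (not_not.1 j.2)).const_mul (S.G.lap i j)
          have t2 : Tendsto (fun t => ∑ j, S.G.lap i j * nx j t) atTop (𝓝 0) := by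
            simpa using tendsto_finsetSum Finset.univ
              fun j _ => (hnx0 j).const_mul (S.G.lap i.1 j)
          simpa using ((t1.const_mul (g.k ℓ h)).const_mul (S.J.eig ℓ)).neg.add
            ((hnx0 i).sub (t2.const_mul (g.k ℓ h)))
      intro i
      by_cases hi : i ∈ S.V3 ℓ h
      · exact h3 i hi
      · exact tendsto_pi_nhds.1 hlim ⟨i, hi⟩
  intro i
  rw [tendsto_pi_nhds]
  rintro ⟨ℓ, h, m⟩
  by_cases hℓ : 1 ≤ |S.J.eig ℓ|
  · exact hu ℓ hℓ h m i
  · exact hd i _ (Or.inl (not_le.1 hℓ))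

/-- Errors supported on the first entry of an unstable miniblock, at the agents outside `V3`, stay there
and evolve by `λ (1 - k L^{ℓ,h})`, while the local observers are exact. -/
theorem Gains.IsObserver.gainCond {g : S.Gains} (hg : g.IsObserver) {ℓ : Fin S.J.r}
    (hℓ : 1 ≤ |S.J.eig ℓ|) (h : Fin (S.J.g ℓ)) :
    GainCond (S.redLap ℓ h) (S.J.eig ℓ) (g.k ℓ h) := by
  rw [gainCond_iff_isSchur hℓ]
  refine isSchur_of_tendsto fun v hv => ?_
  set s₀ : S.J.Idx := ⟨ℓ, h, ⟨0, S.J.d_pos ℓ h⟩⟩ with hs₀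
  -- the estimates: all agents outside `V3` are wrong in the coordinate `s₀` only
  set Y : ℕ → Fin S.N → ℝ := fun t i =>
    if hi : i ∉ S.V3 ℓ h then v t ⟨i, hi⟩ else 0 with hY
  have hYstep : ∀ i ∉ S.V3 ℓ h, ∀ t,
      Y (t + 1) i = S.J.eig ℓ * (Y t i - g.k ℓ h * ∑ j, S.G.lap i j * Y t j) := by
    intro i hi t
    have hsum : ∑ j, S.G.lap i j * Y t j = (S.redLap ℓ h *ᵥ v t) ⟨i, hi⟩ := by
      rw [← sum_subtype_eq_sum {j | j ∉ S.V3 ℓ h}]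
      · refine Finset.sum_congr rfl fun j _ => ?_
        have hj : Y t j = v t j := dif_pos j.2
        rw [hj]
        rfl
      · intro j hj
        have hj : Y t j = 0 := dif_neg hj
        rw [hj, mul_zero]
    rw [hsum]
    simp only [hY, dif_pos hi]
    rw [hv, Matrix.smul_mulVec, Matrix.sub_mulVec, Matrix.one_mulVec, Matrix.smul_mulVec]
    rfl
  set y : Fin S.N → ℕ → S.J.Idx → ℝ := fun i t => Pi.single s₀ (Y t i) with hy
  have hYV3 : ∀ t, ∀ i ∈ S.V3 ℓ h, Y t i = 0 := fun t i hi => dif_neg (not_not.2 hi)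
  have hest : ∀ i t, estimate i (0 : S.Zd i → ℝ) (fun s => y i t s) = y i t := by
    intro i t
    ext s
    unfold estimate
    split_ifs with hs
    · by_cases hss : s = s₀
      · subst hss
        have hi : i ∈ S.V3 ℓ h := hs.elim (fun h => absurd h (not_lt.2 hℓ)) id
        simp [hy, hYV3 t i hi]
      · simp [hy, hss]
    · rfl
  have hcol : ∀ (s : S.J.Idx) (c : ℝ), (S.J.A *ᵥ Pi.single s₀ c) s
      = S.J.eig ℓ * (Pi.single s₀ c : S.J.Idx → ℝ) s := by
    intro s c
    rw [Matrix.mulVec_single]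
    by_cases hss : s = s₀
    · subst hss
      simp [hs₀, S.J.A_apply_same, mul_comm]
    · have h0 : S.J.A s s₀ = 0 := by
        by_contra hne
        obtain ⟨m', hm', hle⟩ := S.J.A_apply_ne_zero hne
        obtain ⟨ℓ', h', m⟩ := s
        simp only [hs₀, Sigma.mk.injEq] at hm'
        obtain ⟨rfl, hm'⟩ := hm'
        rw [heq_eq_eq, Sigma.mk.injEq] at hm'
        obtain ⟨rfl, hm'⟩ := hm'
        rw [heq_eq_eq] at hm'
        subst hm'
        refine hss ?_
        rw [hs₀]
        congr
        exact Fin.ext (Nat.le_zero.1 hle)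
      simp [h0, hss]
  -- the system is at rest and the Luenberger observers are exact
  have hlim := hg (fun _ => 0) (fun _ => 0) (fun i _ => 0) (fun i t s => y i t s)
    (fun t => by simp) (fun i t => by simp) (fun i t => by
      simp only [hest]
      ext s
      rw [Pi.add_apply, Pi.add_apply, consensus_term g i (fun j => y j t), Au_mulVec]
      have hlapy : (fun s' => ∑ j, S.G.lap i j * y j t s')
          = Pi.single s₀ (∑ j, S.G.lap i j * Y t j) := by
        ext s'
        by_cases hss : s' = s₀
        · subst hss
          simp [hy]
        · simp [hy, hss]
      rw [hlapy, hcol, hcol, Matrix.mulVec_zero, Pi.zero_apply]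
      obtain ⟨s, hs⟩ := s
      by_cases hss : s = s₀
      · subst hss
        have hi : i ∉ S.V3 ℓ h := fun hi => notMem_Xd_of_mem_Xu hs (Or.inr hi)
        simp only [hy, Pi.single_eq_same, hYstep i hi t]
        ring
      · simp [hy, hss])
  rw [tendsto_pi_nhds]
  intro i
  have h1 := (tendsto_pi_nhds.1 (hlim i.1) s₀).neg
  simp only [hest] at h1
  have hYi : ∀ t, Y t i = v t i := fun t => dif_pos i.2
  simpa [hy, hYi] using h1

/-! ### The condition for the non-augmented observer -/

theorem selLap_apply (ℓ : Fin S.J.r) (h : Fin (S.J.g ℓ)) (q q' : S.SIdx ℓ h) :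
    S.selLap ℓ h q q' = S.redLap ℓ h q.1.1 q'.1.1 * if q.1.2 = q'.1.2 then 1 else 0 := by
  have h1 : ∀ q b, S.selMat ℓ h q b = if q.1 = b then 1 else 0 := fun q b => by
    simp [selMat, Matrix.one_apply]
  rw [selLap]
  simp only [Matrix.mul_apply, Matrix.transpose_apply, h1, ite_mul, one_mul, zero_mul, mul_ite,
    mul_one, mul_zero, Finset.sum_ite_eq, Finset.mem_univ, if_true]
  simp [Matrix.kroneckerMap_apply, Matrix.one_apply]

/-- The first entry of the miniblock is unobservable for all agents outside `V3`, so that an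
eigenvector of `L^{ℓ,h}`, placed in the first entries, is an eigenvector of
`S (L^{ℓ,h} ⊗ I) Sᵀ` for the same eigenvalue. -/
theorem gainCond_redLap_of_selLap {ℓ : Fin S.J.r} {h : Fin (S.J.g ℓ)} {a k : ℝ}
    (hk : GainCond (S.selLap ℓ h) a k) : GainCond (S.redLap ℓ h) a k := by
  intro μ hμ
  obtain ⟨v, hv0, hv⟩ := eigenvector_of_mem_spectrum hμ
  set m₀ : Fin (S.J.d ℓ h) := ⟨0, S.J.d_pos ℓ h⟩ with hm₀
  have hmem : ∀ i : {i // i ∉ S.V3 ℓ h},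
      h ∈ S.G1 i.1 ℓ ∨ (h ∈ S.G2 i.1 ℓ ∧ (m₀ : ℕ) < S.fst i.1 ℓ h) := by
    intro i
    by_cases h0 : S.Cblk i ℓ h = 0
    · exact Or.inl h0
    · have hpos : 0 < S.fst i ℓ h := Nat.pos_of_ne_zero fun h1 => i.2 ⟨h0, h1⟩
      exact Or.inr ⟨⟨h0, hpos⟩, hpos⟩
  set V : S.SIdx ℓ h → ℂ := fun q => if q.1.2 = m₀ then v q.1.1 else 0 with hV
  have hV0 : V ≠ 0 := by
    obtain ⟨i, hi⟩ := Function.ne_iff.1 hv0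
    intro h0
    refine hi ?_
    have := congrFun h0 ⟨(i, m₀), hmem i⟩
    simpa [hV] using this
  refine hk μ (mem_spectrum_of_eigenvector hV0 ?_)
  ext q
  have hvq := congrFun hv q.1.1
  simp only [Matrix.mulVec, dotProduct, Matrix.map_apply, Pi.smul_apply, smul_eq_mul] at hvq ⊢
  have hsum := sum_subtype_eq_sum
    {q : {i // i ∉ S.V3 ℓ h} × Fin (S.J.d ℓ h) |
      h ∈ S.G1 q.1.1 ℓ ∨ (h ∈ S.G2 q.1.1 ℓ ∧ (q.2 : ℕ) < S.fst q.1.1 ℓ h)}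
    (fun b => algebraMap ℝ ℂ (S.redLap ℓ h q.1.1 b.1 * if q.1.2 = b.2 then 1 else 0)
      * if b.2 = m₀ then v b.1 else 0) (by
        intro b hb
        have hne : b.2 ≠ m₀ := by
          intro h1
          refine hb ?_
          have := hmem b.1
          rwa [← h1] at this
        rw [if_neg hne, mul_zero])
  refine Eq.trans (Finset.sum_congr rfl fun b _ => ?_) (hsum.trans ?_)
  · rw [selLap_apply]
  · rw [Fintype.sum_prod_type]
    simp only [mul_ite, mul_zero, Finset.sum_ite_eq', Finset.mem_univ, if_true]
    by_cases hq : q.1.2 = m₀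
    · simp only [hV, hq, if_true, mul_one]
      exact hvq
    · simp [hV, hq]

end Sys

end DistObs

theorem theorem2 (S : DistObs.Sys) (hdet : S.JointlyDetectable) (hind : S.IndepColumns) :
    ((∃ g : S.Gains, g.IsObserver) ↔
      ∀ ℓ, 1 ≤ |S.J.eig ℓ| → ∀ h, ∃ k : ℝ, DistObs.GainCond (S.redLap ℓ h) (S.J.eig ℓ) k) ∧
    -- the gains can then be chosen so that all local Luenberger observers are asymptotic as well
    ((∃ g : S.Gains, g.IsObserver) →
      ∃ g : S.Gains, (∀ i, DistObs.IsSchur (S.Fd i - g.L i * S.Hd i)) ∧ g.IsObserver) ∧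
    -- the condition is implied by the one for the non-augmented observer
    ((∀ ℓ, 1 ≤ |S.J.eig ℓ| → ∀ h, ∃ k : ℝ, DistObs.GainCond (S.selLap ℓ h) (S.J.eig ℓ) k) →
      ∀ ℓ, 1 ≤ |S.J.eig ℓ| → ∀ h, ∃ k : ℝ, DistObs.GainCond (S.redLap ℓ h) (S.J.eig ℓ) k) := by
  have hnec : (∃ g : S.Gains, g.IsObserver) →
      ∀ ℓ, 1 ≤ |S.J.eig ℓ| → ∀ h, ∃ k : ℝ, DistObs.GainCond (S.redLap ℓ h) (S.J.eig ℓ) k :=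
    fun ⟨g, hg⟩ ℓ hℓ h => ⟨g.k ℓ h, hg.gainCond hℓ h⟩
  have hsuf : (∀ ℓ, 1 ≤ |S.J.eig ℓ| → ∀ h,
      ∃ k : ℝ, DistObs.GainCond (S.redLap ℓ h) (S.J.eig ℓ) k) →
      ∃ g : S.Gains, (∀ i, DistObs.IsSchur (S.Fd i - g.L i * S.Hd i)) ∧ g.IsObserver := by
    intro hk
    choose L hL using DistObs.Sys.exists_isSchur_Fd_sub hind
    choose k hk using hk
    refine ⟨⟨L, fun ℓ h => if hℓ : 1 ≤ |S.J.eig ℓ| then k ℓ hℓ h else 0⟩, hL,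
      DistObs.Sys.isObserver_of_gainCond hL fun ℓ hℓ h => ?_⟩
    simp only [dif_pos hℓ]
    exact hk ℓ hℓ h
  refine ⟨⟨hnec, fun hk => ?_⟩, fun hg => hsuf (hnec hg), fun hk ℓ hℓ h => ?_⟩
  · obtain ⟨g, -, hg⟩ := hsuf hk
    exact ⟨g, hg⟩
  · obtain ⟨k, hk⟩ := hk ℓ hℓ h
    exact ⟨k, DistObs.Sys.gainCond_redLap_of_selLap hk⟩
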